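/- Let $H$ be a complex Hilbert space (not assumed separable) and let $V_1=(V_{1,t})_{t\ge 0}$ and $V_2=(V_{2,t})_{t\ge 0}$ be $C_0$-semigroups (strongly continuous one-parameter semigroups) of bounded operators on $H$. Call $V_1,V_2$ *doubly commuting* if $V_{1,t}V_{2,s}=V_{2,s}V_{1,t}$ and $V_{1,t}V_{2,s}^*=V_{2,s}^*V_{1,t}$ for all $s,t\ge 0$. Call a semigroup $V$ of isometries on $H$ *completely nonunitary* (c.n.u.) if there is no nonzero closed subspace of $H$, invariant under all $V_t$ and all $V_t^*$, on which every $V_t$ restricts to a unitary operator. Let $S_t$ ($t\ge 0$) be the right shift on $L^2(\mathbb R_+)$, $(S_tf)(x)=f(x-t)$ if $x\ge t$ and $0$ otherwise, and let $\mathcal S_{1,t},\mathcal S_{2,t}$ be the operators on $L^2(\mathbb R_+^2)$ with $(\mathcal S_{1,t}f)(x_1,x_2)=f(x_1-t,x_2)$ if $x_1\ge t$ and $0$ otherwise, and $(\mathcal S_{2,t}f)(x_1,x_2)=f(x_1,x_2-t)$ if $x_2\ge t$ and $0$ otherwise. Tensor products are Hilbert space tensor products. Pairs $(V_1,V_2)$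 on $H$ and $(W_1,W_2)$ on $K$ are *jointly unitarily equivalent* if there is one unitary $U:H\to K$ with $W_{j,t}=UV_{j,t}U^*$ for all $t\ge 0$ and $j=1,2$. The pair $(V_1,V_2)$ is called a *bishift-semigroup* if it is jointly unitarily equivalent to $(\mathcal S_1\otimes I_F,\mathcal S_2\otimes I_F)$ on $L^2(\mathbb R_+^2)\otimes F$ for some Hilbert space $F$ (possibly zero). **Theorem.** $V_1$ and $V_2$ are doubly commuting semigroups of isometries, each of which is c.n.u., if and only if $(V_1,V_2)$ is a bishift-semigroup. Moreover, $(V_1,V_2)$ is a bishift-semigroup if and only if there is a Hilbert space $F$ such that $(V_1,V_2)$ is jointly unitarily equivalent to $(S\otimes I_{L^2(\mathbb R_+)}\otimes I_F,\ I_{L^2(\mathbb R_+)}\otimes S\otimes I_F)$ on $L^2(\mathbb R_+)\otimes L^2(\mathbb R_+)\otimes F$. -/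

import Mathlib

open MeasureTheory Set
open scoped NNReal TensorProduct

universe u

noncomputable section

/-- A `C₀`-semigroup `(V_t)_{t ≥ 0}` of bounded operators on a complex Hilbert space:
a strongly continuous one-parameter semigroup. -/
structure C0Semigroup (H : Type*) [NormedAddCommGroup H] [InnerProductSpace ℂ H] where
  /-- The operator `V_t`. -/
  toFun : ℝ≥0 → H →L[ℂ] H
  map_zero' : toFun 0 = 1
  map_add' : ∀ s t : ℝ≥0, toFun (s + t) = toFun s * toFun t
  continuous' : ∀ x : H, Continuous fun t : ℝ≥0 => toFun t x

namespace C0Semigroup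

variable {H : Type*} [NormedAddCommGroup H] [InnerProductSpace ℂ H]

instance : CoeFun (C0Semigroup H) fun _ => ℝ≥0 → H →L[ℂ] H := ⟨toFun⟩

/-- `V` is a semigroup of isometries. -/
def IsIsometric (V : C0Semigroup H) : Prop :=
  ∀ (t : ℝ≥0) (x : H), ‖V t x‖ = ‖x‖

/-- The restrictions of the `V_t` to the subspace `M` are unitary operators of `M`,
i.e. surjective isometries `M → M`. -/
def IsUnitaryOn (V : C0Semigroup H) (M : Submodule ℂ H) : Prop :=
  ∀ t : ℝ≥0, (∀ x ∈ M, ‖V t x‖ = ‖x‖) ∧ V t '' (M : Set H) = (M : Set H)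

variable [CompleteSpace H]

/-- `M` is a reducing subspace of `V`: a closed subspace that is invariant under every `V_t`
and every adjoint `V_t^*`. -/
def IsReducing (V : C0Semigroup H) (M : Submodule ℂ H) : Prop :=
  IsClosed (M : Set H) ∧
    ∀ t : ℝ≥0, ∀ x ∈ M, V t x ∈ M ∧ ContinuousLinearMap.adjoint (V t) x ∈ M

/-- `V` is completely nonunitary: there is no nonzero reducing subspace on which `V` is a
unitary semigroup. -/
def IsCNU (V : C0Semigroup H) : Prop :=
  ¬ ∃ M : Submodule ℂ H, M ≠ ⊥ ∧ V.IsReducing M ∧ V.IsUnitaryOn M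

/-- `V₁` and `V₂` are doubly commuting: every `V₁ t` commutes with every `V₂ s` and with
every adjoint `(V₂ s)^*`. -/
def DoublyCommute (V₁ V₂ : C0Semigroup H) : Prop :=
  ∀ t s : ℝ≥0, V₁ t * V₂ s = V₂ s * V₁ t ∧
    V₁ t * ContinuousLinearMap.adjoint (V₂ s) = ContinuousLinearMap.adjoint (V₂ s) * V₁ t

end C0Semigroup

/-- The Hilbert space tensor product: the completion of the algebraic tensor product with
respect to the inner product `⟪x ⊗ y, x' ⊗ y'⟫ = ⟪x, x'⟫ ⟪y, y'⟫`. -/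
abbrev HilbertTensor (E F : Type*) [NormedAddCommGroup E] [InnerProductSpace ℂ E]
    [NormedAddCommGroup F] [InnerProductSpace ℂ F] : Type _ :=
  UniformSpace.Completion (E ⊗[ℂ] F)

/-- The bounded operator `A ⊗ B` on the Hilbert space tensor product. -/
def opTensor {E F : Type*} [NormedAddCommGroup E] [InnerProductSpace ℂ E]
    [NormedAddCommGroup F] [InnerProductSpace ℂ F] (A : E →L[ℂ] E) (B : F →L[ℂ] F) :
    HilbertTensor E F →L[ℂ] HilbertTensor E F :=
  (TensorProduct.mapL A B).completion

theorem opTensor_tmul {E F : Type*} [NormedAddCommGroup E] [InnerProductSpace ℂ E]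
    [NormedAddCommGroup F] [InnerProductSpace ℂ F] (A : E →L[ℂ] E) (B : F →L[ℂ] F)
    (x : E) (y : F) :
    opTensor A B ((x ⊗ₜ[ℂ] y : E ⊗[ℂ] F) : HilbertTensor E F)
      = ((A x ⊗ₜ[ℂ] B y : E ⊗[ℂ] F) : HilbertTensor E F) := by
  rw [opTensor, ContinuousLinearMap.completion_apply_coe, TensorProduct.mapL_tmul]

section Shift

variable {X : Type*} [MeasurableSpace X] {μ : Measure X}

theorem memLp_indicator_comp {D : Set X} {g : X → X} (hD : MeasurableSet D)
    (hg : MeasurePreserving g (μ.restrict D) μ) (f : Lp ℂ 2 μ) :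
    MemLp (D.indicator fun x => f (g x)) 2 μ :=
  (memLp_indicator_iff_restrict hD).2 ((Lp.memLp f).comp_measurePreserving hg)

/-- For a map `g` that carries the restriction of `μ` to `D` to `μ`, the operator on `L²(μ)`
which sends `f` to the function equal to `f ∘ g` on `D` and to `0` off `D`. -/
def indicatorComp {D : Set X} {g : X → X} (hD : MeasurableSet D)
    (hg : MeasurePreserving g (μ.restrict D) μ) : Lp ℂ 2 μ →L[ℂ] Lp ℂ 2 μ :=
  LinearIsometry.toContinuousLinearMap
    { toFun := fun f => (memLp_indicator_comp hD hg f).toLp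
      map_add' := fun f₁ f₂ => by
        rw [← MemLp.toLp_add, MemLp.toLp_eq_toLp_iff]
        have h := (ae_restrict_iff' hD).1 (hg.quasiMeasurePreserving.ae (Lp.coeFn_add f₁ f₂))
        filter_upwards [h] with x hx
        by_cases hxD : x ∈ D
        · simpa [hxD] using hx hxD
        · simp [hxD]
      map_smul' := fun c f => by
        rw [RingHom.id_apply, ← MemLp.toLp_const_smul, MemLp.toLp_eq_toLp_iff]
        have h := (ae_restrict_iff' hD).1 (hg.quasiMeasurePreserving.ae (Lp.coeFn_smul c f))
        filter_upwards [h] with x hx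
        by_cases hxD : x ∈ D
        · simpa [hxD] using hx hxD
        · simp [hxD]
      norm_map' := fun f => by
        change ‖(memLp_indicator_comp hD hg f).toLp‖ = ‖f‖
        rw [Lp.norm_toLp, Lp.norm_def, eLpNorm_indicator_eq_eLpNorm_restrict hD]
        exact congrArg ENNReal.toReal
          (eLpNorm_comp_measurePreserving (Lp.aestronglyMeasurable f) hg) }

theorem indicatorComp_coeFn {D : Set X} {g : X → X} (hD : MeasurableSet D)
    (hg : MeasurePreserving g (μ.restrict D) μ) (f : Lp ℂ 2 μ) :
    indicatorComp hD hg f =ᵐ[μ] D.indicator fun x => f (g x) :=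
  MemLp.coeFn_toLp (memLp_indicator_comp hD hg f)

end Shift

/-- Lebesgue measure on `ℝ₊ = [0, ∞)`. -/
abbrev halfLine : Measure ℝ := volume.restrict (Ici 0)

/-- Lebesgue measure on the quadrant `ℝ₊² = [0, ∞) × [0, ∞)`. -/
abbrev quadrant : Measure (ℝ × ℝ) := volume.restrict (Ici 0 ×ˢ Ici 0)

theorem measurePreserving_sub_halfLine (t : ℝ≥0) :
    MeasurePreserving (fun x : ℝ => x - t) (halfLine.restrict (Ici (t : ℝ))) halfLine := by
  have h := (measurePreserving_sub_right (volume : Measure ℝ) (t : ℝ)).restrict_preimage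
    (measurableSet_Ici (a := (0 : ℝ)))
  have e : Ici (t : ℝ) ∩ Ici 0 = (fun x : ℝ => x - t) ⁻¹' Ici 0 := by
    ext x
    simp only [mem_inter_iff, mem_Ici, mem_preimage, sub_nonneg]
    exact ⟨fun h => h.1, fun h => ⟨h, t.coe_nonneg.trans h⟩⟩
  rwa [Measure.restrict_restrict measurableSet_Ici, e]

theorem measurePreserving_sub_quadrant₁ (t : ℝ≥0) :
    MeasurePreserving (fun x : ℝ × ℝ => (x.1 - t, x.2))
      (quadrant.restrict {x : ℝ × ℝ | (t : ℝ) ≤ x.1}) quadrant := by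
  have h : MeasurePreserving (fun x : ℝ × ℝ => (x.1 - t, x.2)) volume volume :=
    (measurePreserving_sub_right (volume : Measure ℝ) (t : ℝ)).prod (.id (volume : Measure ℝ))
  have h' := h.restrict_preimage
    ((measurableSet_Ici (a := (0 : ℝ))).prod (measurableSet_Ici (a := (0 : ℝ))))
  have e : {x : ℝ × ℝ | (t : ℝ) ≤ x.1} ∩ Ici 0 ×ˢ Ici 0
      = (fun x : ℝ × ℝ => (x.1 - t, x.2)) ⁻¹' Ici 0 ×ˢ Ici 0 := by
    ext x
    simp only [mem_inter_iff, mem_Ici, mem_preimage, sub_nonneg, mem_prod, mem_ofPred_eq]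
    exact ⟨fun h => ⟨h.1, h.2.2⟩, fun h => ⟨h.1, t.coe_nonneg.trans h.1, h.2⟩⟩
  rwa [Measure.restrict_restrict (measurableSet_le measurable_const measurable_fst), e]

theorem measurePreserving_sub_quadrant₂ (t : ℝ≥0) :
    MeasurePreserving (fun x : ℝ × ℝ => (x.1, x.2 - t))
      (quadrant.restrict {x : ℝ × ℝ | (t : ℝ) ≤ x.2}) quadrant := by
  have h : MeasurePreserving (fun x : ℝ × ℝ => (x.1, x.2 - t)) volume volume :=
    (MeasurePreserving.id (volume : Measure ℝ)).prod
    (measurePreserving_sub_right (volume : Measure ℝ) (t : ℝ))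
  have h' := h.restrict_preimage
    ((measurableSet_Ici (a := (0 : ℝ))).prod (measurableSet_Ici (a := (0 : ℝ))))
  have e : {x : ℝ × ℝ | (t : ℝ) ≤ x.2} ∩ Ici 0 ×ˢ Ici 0
      = (fun x : ℝ × ℝ => (x.1, x.2 - t)) ⁻¹' Ici 0 ×ˢ Ici 0 := by
    ext x
    simp only [mem_inter_iff, mem_Ici, mem_preimage, sub_nonneg, mem_prod, mem_ofPred_eq]
    exact ⟨fun h => ⟨h.2.1, h.1⟩, fun h => ⟨h.2, h.1, t.coe_nonneg.trans h.2⟩⟩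
  rwa [Measure.restrict_restrict (measurableSet_le measurable_const measurable_snd), e]

/-- The right-shift-semigroup `S` on `L²(ℝ₊)`: `(S_t f)(x)` is `f (x - t)` for `x ≥ t` and `0`
otherwise. -/
def rightShift (t : ℝ≥0) : Lp ℂ 2 halfLine →L[ℂ] Lp ℂ 2 halfLine :=
  indicatorComp (D := Ici (t : ℝ)) (g := fun x => x - t)
    measurableSet_Ici (measurePreserving_sub_halfLine t)

/-- The shift in the first variable on `L²(ℝ₊²)`: the value at `(x₁, x₂)` is `f (x₁ - t, x₂)`
for `x₁ ≥ t` and `0` otherwise. -/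
def quadrantShift₁ (t : ℝ≥0) : Lp ℂ 2 quadrant →L[ℂ] Lp ℂ 2 quadrant :=
  indicatorComp (D := {x : ℝ × ℝ | (t : ℝ) ≤ x.1}) (g := fun x => (x.1 - t, x.2))
    (measurableSet_le measurable_const measurable_fst) (measurePreserving_sub_quadrant₁ t)

/-- The shift in the second variable on `L²(ℝ₊²)`: the value at `(x₁, x₂)` is `f (x₁, x₂ - t)`
for `x₂ ≥ t` and `0` otherwise. -/
def quadrantShift₂ (t : ℝ≥0) : Lp ℂ 2 quadrant →L[ℂ] Lp ℂ 2 quadrant :=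
  indicatorComp (D := {x : ℝ × ℝ | (t : ℝ) ≤ x.2}) (g := fun x => (x.1, x.2 - t))
    (measurableSet_le measurable_const measurable_snd) (measurePreserving_sub_quadrant₂ t)

theorem rightShift_coeFn (t : ℝ≥0) (f : Lp ℂ 2 halfLine) :
    rightShift t f =ᵐ[halfLine] fun x => if (t : ℝ) ≤ x then f (x - t) else 0 := by
  refine (indicatorComp_coeFn _ _ f).trans (.of_forall fun x => ?_)
  simp [indicator_apply]

theorem quadrantShift₁_coeFn (t : ℝ≥0) (f : Lp ℂ 2 quadrant) :
    quadrantShift₁ t f =ᵐ[quadrant]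
      fun x => if (t : ℝ) ≤ x.1 then f (x.1 - t, x.2) else 0 := by
  refine (indicatorComp_coeFn _ _ f).trans (.of_forall fun x => ?_)
  simp [indicator_apply]

theorem quadrantShift₂_coeFn (t : ℝ≥0) (f : Lp ℂ 2 quadrant) :
    quadrantShift₂ t f =ᵐ[quadrant]
      fun x => if (t : ℝ) ≤ x.2 then f (x.1, x.2 - t) else 0 := by
  refine (indicatorComp_coeFn _ _ f).trans (.of_forall fun x => ?_)
  simp [indicator_apply]

/-- The pairs `(V₁, V₂)` on `H` and `(W₁, W₂)` on `K` are jointly unitarily equivalent: there is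
a unitary `U : H → K` with `W_{j,t} = U V_{j,t} U^*` for all `t ≥ 0` and `j = 1, 2`. -/
def JointlyUnitarilyEquivalent {H K : Type*} [NormedAddCommGroup H] [InnerProductSpace ℂ H]
    [NormedAddCommGroup K] [InnerProductSpace ℂ K]
    (V₁ V₂ : ℝ≥0 → H →L[ℂ] H) (W₁ W₂ : ℝ≥0 → K →L[ℂ] K) : Prop :=
  ∃ U : H ≃ₗᵢ[ℂ] K, ∀ (t : ℝ≥0) (y : K),
    W₁ t y = U (V₁ t (U.symm y)) ∧ W₂ t y = U (V₂ t (U.symm y))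

/-- `(V₁, V₂)` is a bishift-semigroup: it is jointly unitarily equivalent to the two coordinate
shifts of `L²(ℝ₊²)`, tensored with the identity of some Hilbert space `F`. Such an `F` embeds
isometrically into `H`, so it may be taken in the universe of `H`. -/
def IsBishift {H : Type u} [NormedAddCommGroup H] [InnerProductSpace ℂ H]
    (V₁ V₂ : C0Semigroup H) : Prop :=
  ∃ (F : Type u) (_ : NormedAddCommGroup F) (_ : InnerProductSpace ℂ F) (_ : CompleteSpace F),
    JointlyUnitarilyEquivalent (K := HilbertTensor (Lp ℂ 2 quadrant) F) V₁ V₂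
      (fun t => opTensor (quadrantShift₁ t) (.id ℂ F))
      (fun t => opTensor (quadrantShift₂ t) (.id ℂ F))

/-- `(V₁, V₂)` is jointly unitarily equivalent to `(S ⊗ I ⊗ I_F, I ⊗ S ⊗ I_F)` on
`L²(ℝ₊) ⊗ L²(ℝ₊) ⊗ F` for some Hilbert space `F`. -/
def IsTensorBishift {H : Type u} [NormedAddCommGroup H] [InnerProductSpace ℂ H]
    (V₁ V₂ : C0Semigroup H) : Prop :=
  ∃ (F : Type u) (_ : NormedAddCommGroup F) (_ : InnerProductSpace ℂ F) (_ : CompleteSpace F),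
    JointlyUnitarilyEquivalent
      (K := HilbertTensor (HilbertTensor (Lp ℂ 2 halfLine) (Lp ℂ 2 halfLine)) F) V₁ V₂
      (fun t => opTensor (opTensor (rightShift t) (.id ℂ _)) (.id ℂ F))
      (fun t => opTensor (opTensor (.id ℂ _) (rightShift t)) (.id ℂ F))

end

/-!
The proof compares all pairs with a family of translated exponentials, and uses neither generators
nor the Wold decomposition.

In `L²(ℝ₊)` put `e(x) = √2 exp (-x)`. Then `(S_t)^* e = exp (-t) e`, the Gram matrix of the
translates is `⟪S_s e, S_t e⟫ = exp (-|s - t|)`, and the translates span a dense subspace, because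
`exp (-s) S_s e` is the restriction of `e` to `[s, ∞)` (`dense_span_range_of_indicator`). Taking
products in two variables and tensoring with `F`, both `L²(ℝ₊²) ⊗ F` and `L²(ℝ₊) ⊗ L²(ℝ₊) ⊗ F` get
a family `v s u φ`, for `φ` in `F`, which the two shifts translate, which spans a dense subspace, and
whose Gram matrix is `exp (-|s - s'|) exp (-|u - u'|) ⟪φ, ψ⟫`. This is `IsBishiftSystem`. Since a
family with dense span is determined up to a unitary by its Gram matrix, two pairs of semigroups
with such systems over the same `F` are jointly unitarily equivalent, which identifies the two
models. The adjoints of the shifts can be read off from the system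
(`IsBishiftSystem.adjoint_apply`), and this gives isometry, double commutativity and complete
nonunitarity.

It remains to find a system for a doubly commuting pair of c.n.u. semigroups of isometries. Let `F`
be the space of all `φ` with `(V_{j,t})^* φ = exp (-t) φ` for `j = 1, 2`, and put
`v s u φ = V_{1,s} V_{2,u} φ`; the Gram matrix is right by double commutativity. Density of the span
follows from the existence of enough eigenvectors (`C0Semigroup.IsIsometric.exists_mem_decaySubspace`):
if `V` is a c.n.u. semigroup of isometries and `N ≠ 0` reduces `V`, then `N` contains `φ ≠ 0` with
`(V_t)^* φ = exp (-t) φ` for all `t`. To see this, choose `a > 0` and `0 ≠ x ∈ N` with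
`(V_a)^* x = 0`, and let `ψ = ∑ₙ exp (-n a) V_{na} x`, so that `(V_a)^* ψ = exp (-a) ψ`. Then
`s ↦ exp s • (V_s)^* ψ` is `a`-periodic, and each of its Fourier modes is an eigenvector of every
`(V_t)^*`, with eigenvalue `exp (-μ t)` for some `μ` with real part `1`. Some mode `φ` is not zero,
and `φ + (μ - 1) ∫ exp (-s) V_s φ ds` is a nonzero eigenvector with eigenvalue `exp (-t)`.
-/

/-! ### Systems of translated exponentials -/

/-- A family `v s u φ` in `K`, with `s, u ≥ 0` and `φ` in an inner product space `F`, that behaves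
under `(W₁, W₂)` and under inner products like the functions
`(x, y) ↦ 2 exp (s - x) exp (u - y) 1_{x ≥ s, y ≥ u} φ` under the two coordinate shifts of
`L²(ℝ₊²; F)`. -/
structure IsBishiftSystem {K F : Type*} [NormedAddCommGroup K] [InnerProductSpace ℂ K]
    [NormedAddCommGroup F] [InnerProductSpace ℂ F]
    (W₁ W₂ : ℝ≥0 → K →L[ℂ] K) (v : ℝ≥0 → ℝ≥0 → F → K) : Prop where
  shift₁ : ∀ t s u φ, W₁ t (v s u φ) = v (t + s) u φ
  shift₂ : ∀ t s u φ, W₂ t (v s u φ) = v s (t + u) φ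
  gram : ∀ s u φ s' u' ψ, inner ℂ (v s u φ) (v s' u' ψ) =
    ((Real.exp (-|(s : ℝ) - s'|) * Real.exp (-|(u : ℝ) - u'|) : ℝ) : ℂ) * inner ℂ φ ψ
  dense : Dense (Submodule.span ℂ (range fun p : ℝ≥0 × ℝ≥0 × F => v p.1 p.2.1 p.2.2) : Set K)

section Gram

variable {H K : Type*} [NormedAddCommGroup H] [InnerProductSpace ℂ H]
  [NormedAddCommGroup K] [InnerProductSpace ℂ K]

theorem inner_linearCombination {ι : Type*} (v : ι → H) (c d : ι →₀ ℂ) :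
    inner ℂ (Finsupp.linearCombination ℂ v c) (Finsupp.linearCombination ℂ v d) =
      c.sum fun i a => d.sum fun j b => (starRingEnd ℂ) a * (b * inner ℂ (v i) (v j)) := by
  simp only [Finsupp.linearCombination_apply, Finsupp.sum, sum_inner, inner_sum,
    inner_smul_left, inner_smul_right, Finset.mul_sum]
  rw [Finset.sum_comm]
  exact Finset.sum_congr rfl fun i _ => Finset.sum_congr rfl fun j _ => by ring

/-- Two families with dense spans and the same Gram matrix differ by a unitary. -/
theorem exists_linearIsometryEquiv_of_gram_eq [CompleteSpace H] [CompleteSpace K] {ι : Type*}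
    {v : ι → H} {w : ι → K}
    (hv : Dense (Submodule.span ℂ (range v) : Set H))
    (hw : Dense (Submodule.span ℂ (range w) : Set K))
    (h : ∀ i j, inner ℂ (v i) (v j) = inner ℂ (w i) (w j)) :
    ∃ U : H ≃ₗᵢ[ℂ] K, ∀ i, U (v i) = w i := by
  have dv : DenseRange (Finsupp.linearCombination ℂ v) := by
    rw [DenseRange, ← LinearMap.coe_range, Finsupp.range_linearCombination]; exact hv
  have dw : DenseRange (Finsupp.linearCombination ℂ w) := by
    rw [DenseRange, ← LinearMap.coe_range, Finsupp.range_linearCombination]; exact hw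
  have hn (c : ι →₀ ℂ) : ‖Finsupp.linearCombination ℂ w (LinearEquiv.refl ℂ (ι →₀ ℂ) c)‖ =
      ‖Finsupp.linearCombination ℂ v c‖ := by
    rw [LinearEquiv.refl_apply, @norm_eq_sqrt_re_inner ℂ, @norm_eq_sqrt_re_inner ℂ,
      inner_linearCombination, inner_linearCombination]
    simp only [h]
  refine ⟨LinearEquiv.extendOfIsometry (LinearEquiv.refl ℂ (ι →₀ ℂ)) _ _ dv dw hn, fun i => ?_⟩
  simpa using LinearEquiv.extendOfIsometry_eq (LinearEquiv.refl ℂ (ι →₀ ℂ)) _ _ dv dw hn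
    (Finsupp.single i 1)

theorem eq_of_forall_inner_eq_of_dense_span {ι : Type*} {v : ι → H}
    (hv : Dense (Submodule.span ℂ (range v) : Set H)) {x y : H}
    (h : ∀ i, inner ℂ x (v i) = inner ℂ y (v i)) : x = y := by
  have : innerSL ℂ x = innerSL ℂ y := by
    refine ContinuousLinearMap.ext_on hv ?_
    rintro _ ⟨i, rfl⟩
    simpa using h i
  exact ext_inner_right ℂ fun z => by simpa using congrArg (fun f => f z) this

theorem mem_orthogonal_span_range {ι : Type*} {v : ι → H} {x : H} :
    x ∈ (Submodule.span ℂ (range v))ᗮ ↔ ∀ i, inner ℂ (v i) x = 0 := by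
  refine ⟨fun h i => (Submodule.mem_orthogonal _ _).1 h _ (Submodule.subset_span ⟨i, rfl⟩),
    fun h => (Submodule.mem_orthogonal _ _).2 fun w hw => ?_⟩
  induction hw using Submodule.span_induction with
  | mem w hw => obtain ⟨i, rfl⟩ := hw; exact h i
  | zero => exact inner_zero_left _
  | add a b _ _ ha hb => rw [inner_add_left, ha, hb, add_zero]
  | smul c a _ ha => rw [inner_smul_left, ha, mul_zero]

end Gram

namespace IsBishiftSystem

variable {H K F : Type*} [NormedAddCommGroup H] [InnerProductSpace ℂ H]
  [NormedAddCommGroup K] [InnerProductSpace ℂ K] [NormedAddCommGroup F] [InnerProductSpace ℂ F]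
  {V₁ V₂ : ℝ≥0 → H →L[ℂ] H} {W₁ W₂ : ℝ≥0 → K →L[ℂ] K}
  {v : ℝ≥0 → ℝ≥0 → F → H} {w : ℝ≥0 → ℝ≥0 → F → K}

theorem swap (h : IsBishiftSystem V₁ V₂ v) : IsBishiftSystem V₂ V₁ fun s u => v u s where
  shift₁ t s u φ := h.shift₂ t u s φ
  shift₂ t s u φ := h.shift₁ t u s φ
  gram s u φ s' u' ψ := by rw [h.gram, mul_comm (Real.exp _)]
  dense := by
    convert h.dense using 3
    ext x
    constructor
    · rintro ⟨⟨s, u, φ⟩, rfl⟩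
      exact ⟨⟨u, s, φ⟩, rfl⟩
    · rintro ⟨⟨s, u, φ⟩, rfl⟩
      exact ⟨⟨u, s, φ⟩, rfl⟩

/-- The Gram matrix and the action on the family do not depend on the space, so two bishift systems
over the same `F` are matched by a unitary that intertwines the shifts. -/
theorem jointlyUnitarilyEquivalent [CompleteSpace H] [CompleteSpace K]
    (hv : IsBishiftSystem V₁ V₂ v) (hw : IsBishiftSystem W₁ W₂ w) :
    JointlyUnitarilyEquivalent V₁ V₂ W₁ W₂ := by
  obtain ⟨U, hU⟩ := exists_linearIsometryEquiv_of_gram_eq hv.dense hw.dense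
    fun p q => by rw [hv.gram, hw.gram]
  have hU' (s u φ) : U (v s u φ) = w s u φ := hU (s, u, φ)
  have hs (s u φ) : U.symm (w s u φ) = v s u φ := by rw [← hU', U.symm_apply_apply]
  have ext {A B : K →L[ℂ] K} (h : ∀ s u φ, A (w s u φ) = B (w s u φ)) : A = B := by
    refine ContinuousLinearMap.ext_on hw.dense ?_
    rintro _ ⟨p, rfl⟩
    exact h _ _ _
  refine ⟨U, fun t y => ⟨?_, ?_⟩⟩
  · refine congrArg (fun A : K →L[ℂ] K => A y) (ext (A := W₁ t)
      (B := (U : H →L[ℂ] K) ∘L V₁ t ∘L (U.symm : K →L[ℂ] H)) fun s u φ => ?_)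
    simp [hs, hU', hv.shift₁, hw.shift₁]
  · refine congrArg (fun A : K →L[ℂ] K => A y) (ext (A := W₂ t)
      (B := (U : H →L[ℂ] K) ∘L V₂ t ∘L (U.symm : K →L[ℂ] H)) fun s u φ => ?_)
    simp [hs, hU', hv.shift₂, hw.shift₂]

theorem of_jointlyUnitarilyEquivalent (hw : IsBishiftSystem W₁ W₂ w)
    (h : JointlyUnitarilyEquivalent V₁ V₂ W₁ W₂) :
    ∃ v : ℝ≥0 → ℝ≥0 → F → H, IsBishiftSystem V₁ V₂ v := by
  obtain ⟨U, hU⟩ := h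
  refine ⟨fun s u φ => U.symm (w s u φ), fun t s u φ => ?_, fun t s u φ => ?_,
    fun s u φ s' u' ψ => ?_, ?_⟩
  · rw [← hw.shift₁, (hU t _).1, U.symm_apply_apply]
  · rw [← hw.shift₂, (hU t _).2, U.symm_apply_apply]
  · rw [LinearIsometryEquiv.inner_map_map, hw.gram]
  · have := U.symm.surjective.denseRange.dense_image U.symm.continuous hw.dense
    convert this using 1
    rw [show (fun p : ℝ≥0 × ℝ≥0 × F => U.symm (w p.1 p.2.1 p.2.2)) =
      (U.symm.toLinearEquiv : K →ₗ[ℂ] H) ∘ fun p => w p.1 p.2.1 p.2.2 from rfl,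
      range_comp, Submodule.span_image]
    rfl

variable [CompleteSpace H]

/-- The adjoint of a shift moves `v s u φ` back as far as `v 0 u φ`, and contributes a factor
`exp (-1)` for each unit of time that is then left. -/
theorem adjoint_apply (hv : IsBishiftSystem V₁ V₂ v) (t s u : ℝ≥0) (φ : F) :
    ContinuousLinearMap.adjoint (V₁ t) (v s u φ) =
      ((Real.exp (-((t - s : ℝ≥0) : ℝ)) : ℝ) : ℂ) • v (s - t) u φ := by
  refine eq_of_forall_inner_eq_of_dense_span hv.dense fun ⟨s', u', ψ⟩ => ?_
  rw [ContinuousLinearMap.adjoint_inner_left, hv.shift₁, hv.gram, inner_smul_left, hv.gram,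
    Complex.conj_ofReal, ← mul_assoc, ← Complex.ofReal_mul, ← mul_assoc]
  congr 3
  rw [← Real.exp_add]
  congr 1
  have := s'.coe_nonneg
  rcases le_total s t with hst | hst
  · rw [tsub_eq_zero_of_le hst, NNReal.coe_sub hst]
    have : (s : ℝ) ≤ t := hst
    push_cast
    rw [abs_of_nonpos (by linarith), abs_of_nonpos (by linarith)]
    ring
  · rw [tsub_eq_zero_of_le hst, NNReal.coe_sub hst]
    push_cast
    rw [sub_sub, neg_zero, zero_add]

end IsBishiftSystem

section Consequences

variable {H F : Type*} [NormedAddCommGroup H] [InnerProductSpace ℂ H] [NormedAddCommGroup F]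
  [InnerProductSpace ℂ F] {V₁ V₂ : C0Semigroup H} {v : ℝ≥0 → ℝ≥0 → F → H}

theorem C0Semigroup.adjoint_apply_self [CompleteSpace H] {V : C0Semigroup H} (hV : V.IsIsometric)
    (t : ℝ≥0) (x : H) :
    ContinuousLinearMap.adjoint (V t) (V t x) = x := by
  have := (ContinuousLinearMap.norm_map_iff_adjoint_comp_self (V t)).1 (hV t)
  exact congrArg (fun A : H →L[ℂ] H => A x) this

theorem IsBishiftSystem.isIsometric [CompleteSpace H] (hv : IsBishiftSystem V₁ V₂ v) :
    V₁.IsIsometric := by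
  intro t
  refine (ContinuousLinearMap.norm_map_iff_adjoint_comp_self (V₁ t)).2
    (ContinuousLinearMap.ext_on hv.dense ?_)
  rintro _ ⟨⟨s, u, φ⟩, rfl⟩
  have : t - (t + s) = 0 := tsub_eq_zero_of_le le_self_add
  simp [hv.shift₁, hv.adjoint_apply, this]

theorem IsBishiftSystem.doublyCommute [CompleteSpace H] (hv : IsBishiftSystem V₁ V₂ v) :
    V₁.DoublyCommute V₂ := by
  refine fun t s => ⟨ContinuousLinearMap.ext_on hv.dense ?_,
    ContinuousLinearMap.ext_on hv.dense ?_⟩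
  · rintro _ ⟨⟨s, u, φ⟩, rfl⟩
    simp [hv.shift₁, hv.shift₂]
  · rintro _ ⟨⟨s, u, φ⟩, rfl⟩
    have := hv.swap.adjoint_apply
    simp [hv.shift₁, this]

/-- On a reducing subspace where `V₁` is unitary, `x = V₁ t (V₁ t)^* x`. Hence
`|⟪x, v s u φ⟫| ≤ ‖x‖ ‖(V₁ t)^* v s u φ‖`, and the right-hand side tends to `0`. -/
theorem IsBishiftSystem.isCNU [CompleteSpace H] (hv : IsBishiftSystem V₁ V₂ v) :
    V₁.IsCNU := by
  rintro ⟨M, hM, -, hU⟩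
  refine hM ((Submodule.eq_bot_iff _).2 fun x hx => ?_)
  refine eq_of_forall_inner_eq_of_dense_span hv.dense fun ⟨s, u, φ⟩ => ?_
  rw [inner_zero_left]
  have key (r : ℝ≥0) :
      ‖inner ℂ x (v s u φ)‖ ≤ ‖x‖ * (Real.exp (-(r : ℝ)) * ‖v 0 u φ‖) := by
    -- Time `s + r` uses up `s` and leaves the factor `exp (-r)`.
    obtain ⟨y, -, rfl⟩ := (hU (s + r)).2.symm.subset hx
    rw [← ContinuousLinearMap.adjoint_inner_right, hv.adjoint_apply, hv.isIsometric]
    refine (norm_inner_le_norm _ _).trans ?_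
    rw [norm_smul, add_tsub_cancel_left, tsub_eq_zero_of_le le_self_add, Complex.norm_real,
      Real.norm_eq_abs, Real.abs_exp]
  have lim : Filter.Tendsto (fun r : ℝ => ‖x‖ * (Real.exp (-r) * ‖v 0 u φ‖))
      Filter.atTop (nhds (‖x‖ * (0 * ‖v 0 u φ‖))) :=
    ((Real.tendsto_exp_neg_atTop_nhds_zero).mul_const _).const_mul _
  rw [zero_mul, mul_zero] at lim
  refine norm_le_zero_iff.1 (ge_of_tendsto lim ?_)
  filter_upwards [Filter.eventually_ge_atTop 0] with r hr using key ⟨r, hr⟩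

end Consequences

/-! ### Exponential eigenvectors of the adjoint semigroup -/

section Integral

variable {H : Type*} [NormedAddCommGroup H] [InnerProductSpace ℂ H] [CompleteSpace H]

theorem Submodule.integral_mem_of_isClosed {α : Type*} [MeasurableSpace α] {μ : Measure α}
    {N : Submodule ℂ H} (hN : IsClosed (N : Set H)) {f : α → H} (hf : ∀ a, f a ∈ N) :
    ∫ a, f a ∂μ ∈ N := by
  by_cases hi : Integrable f μ
  · have : CompleteSpace N := hN.completeSpace_coe
    rw [← Submodule.starProjection_eq_self_iff, ← ContinuousLinearMap.integral_comp_comm _ hi]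
    exact integral_congr_ae (.of_forall fun a => Submodule.starProjection_eq_self_iff.2 (hf a))
  · rw [integral_undef hi]
    exact N.zero_mem

end Integral

/-- If a continuous function on `[0, a]` with equal end values has vanishing Fourier
coefficients, then it vanishes at `0`. -/
theorem apply_zero_eq_zero_of_forall_integral_exp_eq_zero {a : ℝ} (ha : 0 < a) {f : ℝ → ℂ}
    (hf : Continuous f) (hper : f 0 = f a)
    (h : ∀ n : ℤ,
      ∫ s in (0 : ℝ)..a, Complex.exp (-(2 * Real.pi * Complex.I * n / a) * s) * f s = 0) :
    f 0 = 0 := by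
  have : Fact (0 < a) := ⟨ha⟩
  let g : C(AddCircle a, ℂ) :=
    ⟨AddCircle.liftIco a 0 f, AddCircle.liftIco_zero_continuous hper hf.continuousOn⟩
  have hg : fourierCoeff g = 0 := by
    funext n
    change fourierCoeff (AddCircle.liftIco a 0 f) n = 0
    rw [fourierCoeff_liftIco_eq, fourierCoeffOn_eq_integral]
    convert smul_zero _
    rw [← h n]
    simp only [zero_add]
    refine intervalIntegral.integral_congr fun s _ => ?_
    simp only [fourier_coe_apply, smul_eq_mul]
    congr 2
    push_cast
    ring
  have hs := has_pointwise_sum_fourier_series_of_summable (f := g)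
    (by rw [hg]; exact summable_zero) (0 : ℝ)
  simp only [hg, Pi.zero_apply, zero_smul] at hs
  have h0 : g ((0 : ℝ) : AddCircle a) = f 0 := AddCircle.liftIco_coe_apply ⟨le_rfl, by simpa⟩
  rw [← h0]
  exact hs.unique hasSum_zero

namespace C0Semigroup

open scoped InnerProduct

variable {H : Type*} [NormedAddCommGroup H] [InnerProductSpace ℂ H] [CompleteSpace H]
  {V : C0Semigroup H}

theorem adjoint_add_apply (V : C0Semigroup H) (s t : ℝ≥0) (x : H) :
    ((V (s + t))†) x = ((V s)†) (((V t)†) x) := by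
  rw [add_comm, V.map_add', ContinuousLinearMap.mul_def, ContinuousLinearMap.adjoint_comp]
  rfl

theorem adjoint_zero_apply (V : C0Semigroup H) (x : H) : ((V 0)†) x = x := by
  rw [V.map_zero', ContinuousLinearMap.one_def, ContinuousLinearMap.adjoint_id]
  rfl

theorem IsIsometric.norm_adjoint_apply_le (hV : V.IsIsometric) (t : ℝ≥0) (x : H) :
    ‖((V t)†) x‖ ≤ ‖x‖ := by
  refine ContinuousLinearMap.le_of_opNorm_le_of_le _ ?_ le_rfl |>.trans_eq (one_mul _)
  rw [LinearIsometryEquiv.norm_map]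
  exact ContinuousLinearMap.opNorm_le_bound _ zero_le_one fun y => by rw [hV, one_mul]

/-- Strong continuity of the adjoint semigroup comes from that of `V`: contractivity gives
`‖x - (V r)^* x‖² ≤ 2 ‖x‖² - 2 re ⟪x, V r x⟫`. -/
theorem IsIsometric.norm_adjoint_apply_sub_sq_le (hV : V.IsIsometric) (s t : ℝ≥0) (x : H) :
    ‖((V s)†) x - ((V t)†) x‖ ^ 2 ≤ 2 * (‖x‖ * ‖x - V (nndist s t) x‖) := by
  wlog hst : s ≤ t generalizing s t
  · rw [norm_sub_rev, nndist_comm]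
    exact this t s (le_of_not_ge hst)
  obtain ⟨r, rfl⟩ := exists_add_of_le hst
  have hr : nndist s (s + r) = r := by
    ext
    rw [coe_nndist, NNReal.dist_eq, NNReal.coe_add, sub_add_cancel_left, abs_neg, NNReal.abs_eq]
  rw [hr, adjoint_add_apply, ← map_sub]
  have h₁ : ‖((V s)†) (x - ((V r)†) x)‖ ^ 2 ≤ ‖x - ((V r)†) x‖ ^ 2 := by
    gcongr
    exact hV.norm_adjoint_apply_le _ _
  have h₂ : ‖((V r)†) x‖ ^ 2 ≤ ‖x‖ ^ 2 := by
    gcongr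
    exact hV.norm_adjoint_apply_le _ _
  have h₃ := norm_sub_sq (𝕜 := ℂ) x (((V r)†) x)
  rw [ContinuousLinearMap.adjoint_inner_right, ← inner_conj_symm, RCLike.conj_re] at h₃
  have h₄ := re_inner_le_norm (𝕜 := ℂ) x (x - V r x)
  rw [inner_sub_right, map_sub, ← norm_sq_eq_re_inner] at h₄
  linarith

theorem IsIsometric.continuous_adjoint_apply (hV : V.IsIsometric) (x : H) :
    Continuous fun t => ((V t)†) x := by
  refine continuous_iff_continuousAt.2 fun t => ?_
  rw [ContinuousAt, tendsto_iff_norm_sub_tendsto_zero]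
  have h : Filter.Tendsto (fun s => √(2 * (‖x‖ * ‖x - V (nndist s t) x‖))) (nhds t) (nhds 0) := by
    have c : Continuous fun s => √(2 * (‖x‖ * ‖x - V (nndist s t) x‖)) := by
      have := (V.continuous' x).comp (continuous_id.nndist (continuous_const (y := t)))
      simp only [Function.comp_def, id_eq] at this
      fun_prop
    simpa [V.map_zero'] using c.tendsto t
  exact squeeze_zero (fun _ => norm_nonneg _)
    (fun s => Real.le_sqrt_of_sq_le (hV.norm_adjoint_apply_sub_sq_le s t x)) h

theorem IsIsometric.adjoint_apply_add (hV : V.IsIsometric) (s t : ℝ≥0) (x : H) :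
    ((V s)†) (V (s + t) x) = V t x := by
  rw [V.map_add']
  exact C0Semigroup.adjoint_apply_self hV s _

theorem IsIsometric.adjoint_add_apply_left (hV : V.IsIsometric) (s t : ℝ≥0) (x : H) :
    ((V (s + t))†) (V s x) = ((V t)†) x := by
  rw [add_comm, adjoint_add_apply, C0Semigroup.adjoint_apply_self hV]

/-- A vector `x` killed by `(V a)^*` generates the eigenvector `∑ₙ exp (-n a) V_{na} x` of `(V a)^*`
with eigenvalue `exp (-a)`. -/
theorem IsIsometric.exists_adjoint_apply_eq_exp_smul (hV : V.IsIsometric) {N : Submodule ℂ H}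
    (hN : V.IsReducing N) {a : ℝ≥0} (ha : 0 < a) {x : H} (hx : x ∈ N) (hx0 : x ≠ 0)
    (hax : ((V a)†) x = 0) :
    ∃ ψ ∈ N, ψ ≠ 0 ∧ ((V a)†) ψ = Complex.exp (-(a : ℝ)) • ψ := by
  let f : ℕ → H := fun n => Complex.exp (-(a : ℝ)) ^ n • V (n * a) x
  have hf : Summable f := by
    refine Summable.of_norm_bounded (g := fun n => Real.exp (-a) ^ n * ‖x‖) ?_ fun n => ?_
    · exact (summable_geometric_of_lt_one (Real.exp_nonneg _)
        (Real.exp_lt_one_iff (x := -(a : ℝ)) |>.2 (by simpa using ha))).mul_right _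
    · rw [norm_smul, norm_pow, Complex.norm_exp, hV]
      simp
  have hstep (n : ℕ) : f (n + 1) = Complex.exp (-(a : ℝ)) • V a (f n) := by
    change Complex.exp _ ^ (n + 1) • V ((n + 1 : ℕ) * a) x = _ • V a (_ • V (n * a) x)
    rw [map_smul, smul_smul, ← pow_succ',
      show ((n + 1 : ℕ) : ℝ≥0) * a = a + n * a by push_cast; ring, V.map_add']
    rfl
  -- The series is the solution of `ψ = x + exp (-a) V_a ψ`.
  have hfix : ∑' n, f n = x + Complex.exp (-(a : ℝ)) • V a (∑' n, f n) := by
    rw [(V a).map_tsum hf, ← Summable.tsum_const_smul _ ((V a).summable hf), hf.tsum_eq_zero_add]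
    simp only [hstep]
    simp [f, V.map_zero']
  refine ⟨∑' n, f n, ?_, fun h0 => hx0 ?_, ?_⟩
  · exact tsum_mem hN.1 fun n => N.smul_mem _ (hN.2 _ x hx).1
  · rw [h0, map_zero, smul_zero, add_zero] at hfix
    exact hfix.symm
  · conv_lhs => rw [hfix]
    rw [map_add, hax, zero_add, map_smul, C0Semigroup.adjoint_apply_self hV]

/-- The Fourier modes of the `a`-periodic function `s ↦ exp s • (V s)^* ψ` are joint eigenvectors
of the operators `(V t)^*`. -/
theorem IsIsometric.exists_adjoint_eigenvector (hV : V.IsIsometric) {N : Submodule ℂ H}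
    (hN : V.IsReducing N) {a : ℝ≥0} (ha : 0 < a) {ψ : H} (hψ : ψ ∈ N) (hψ0 : ψ ≠ 0)
    (haψ : ((V a)†) ψ = Complex.exp (-(a : ℝ)) • ψ) :
    ∃ μ : ℂ, μ.re = 1 ∧ ∃ φ ∈ N, φ ≠ 0 ∧ ∀ t : ℝ≥0, ((V t)†) φ = Complex.exp (-(μ * t)) • φ := by
  have ha' : (a : ℂ) ≠ 0 := by simpa using ha.ne'
  -- The numbers `μ` with `exp (μ a) = exp a`; the mode of index `n` has eigenvalue `exp (-μ n t)`.
  let μ : ℤ → ℂ := fun n => 1 - 2 * Real.pi * Complex.I * n / (a : ℝ)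
  have hμre (n) : (μ n).re = 1 := by
    have : 2 * Real.pi * Complex.I * n / (a : ℝ) =
      ((2 * Real.pi * n / (a : ℝ) : ℝ) : ℂ) * Complex.I := by push_cast; ring
    simp only [μ]
    rw [this]
    simp
  have hμa (n) : Complex.exp (μ n * a) = Complex.exp (a : ℝ) := by
    have : μ n * a = (a : ℝ) + (-n : ℤ) * (2 * Real.pi * Complex.I) := by
      simp only [μ]
      push_cast
      field_simp
      ring
    rw [this, Complex.exp_periodic.int_mul]
  let g : ℤ → ℝ → H := fun n s => Complex.exp (μ n * s) • ((V s.toNNReal)†) ψ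
  have hg (n) : Continuous (g n) := by
    have := (hV.continuous_adjoint_apply ψ).comp continuous_real_toNNReal
    simp only [Function.comp_def] at this
    fun_prop
  have hper (n) {s : ℝ} (hs : 0 ≤ s) : g n (s + a) = g n s := by
    simp only [g]
    rw [Real.toNNReal_add hs a.coe_nonneg, Real.toNNReal_coe, adjoint_add_apply, haψ, map_smul,
      smul_smul]
    congr 1
    push_cast
    rw [mul_add, Complex.exp_add, hμa, mul_assoc, ← Complex.exp_add]
    simp
  have hshift (n) {t : ℝ} (ht : 0 ≤ t) : ∫ s in t..t + a, g n s = ∫ s in (0 : ℝ)..a, g n s := by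
    have hi (x y : ℝ) : IntervalIntegrable (g n) volume x y := (hg n).intervalIntegrable _ _
    have h₁ := intervalIntegral.integral_add_adjacent_intervals (hi 0 t) (hi t (t + a))
    have h₂ := intervalIntegral.integral_add_adjacent_intervals (hi 0 a) (hi a (t + a))
    have h₃ : ∫ s in (a : ℝ)..t + a, g n s = ∫ s in (0 : ℝ)..t, g n s := by
      have := intervalIntegral.integral_comp_add_right (a := 0) (b := t) (g n) (a : ℝ)
      rw [zero_add] at this
      rw [← this]
      refine intervalIntegral.integral_congr fun s hs => hper n ?_
      rw [uIcc_of_le ht] at hs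
      exact hs.1
    rw [h₃, add_comm] at h₂
    exact add_left_cancel (h₁.trans h₂.symm)
  -- If every mode vanished, the scalar function `s ↦ exp s * ⟪ψ, (V s)^* ψ⟫` would vanish at `0`.
  obtain ⟨n, hn⟩ : ∃ n, ∫ s in (0 : ℝ)..a, g n s ≠ 0 := by
    by_contra! h0
    refine hψ0 ?_
    have hc : Continuous fun s : ℝ => Complex.exp s * inner ℂ ψ (((V s.toNNReal)†) ψ) := by
      have := (hV.continuous_adjoint_apply ψ).comp continuous_real_toNNReal
      simp only [Function.comp_def] at this
      fun_prop
    have := apply_zero_eq_zero_of_forall_integral_exp_eq_zero (a := a) (by simpa using ha) hc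
      ?_ fun n => ?_
    · simpa [adjoint_zero_apply] using this
    · simp only [Real.toNNReal_coe, haψ, inner_smul_right, ← mul_assoc, ← Complex.exp_add]
      simp [adjoint_zero_apply]
    · have := ContinuousLinearMap.intervalIntegral_comp_comm (innerSL ℂ ψ)
        ((hg n).intervalIntegrable 0 (a : ℝ) (μ := volume))
      rw [h0 n, map_zero] at this
      rw [← this]
      refine intervalIntegral.integral_congr fun s _ => ?_
      simp only [g, innerSL_apply_apply, inner_smul_right, ← mul_assoc, ← Complex.exp_add, μ]
      congr 2
      ring
  refine ⟨μ n, hμre n, _, ?_, hn, fun t => ?_⟩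
  · rw [intervalIntegral.integral_of_le a.coe_nonneg]
    exact Submodule.integral_mem_of_isClosed hN.1 fun s => N.smul_mem _ (hN.2 _ ψ hψ).2
  -- `(V t)^*` translates the integrand by `t`, which does not affect the integral over a period.
  · rw [← ContinuousLinearMap.intervalIntegral_comp_comm _ ((hg n).intervalIntegrable _ _)]
    have h₁ := intervalIntegral.integral_comp_add_right (a := 0) (b := a) (g n) (t : ℝ)
    rw [zero_add, add_comm (a : ℝ), hshift n t.coe_nonneg] at h₁
    rw [← h₁, ← intervalIntegral.integral_smul]
    refine intervalIntegral.integral_congr fun s hs => ?_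
    rw [uIcc_of_le a.coe_nonneg] at hs
    simp only [g]
    rw [map_smul, smul_smul, ← Complex.exp_add, add_comm s, Real.toNNReal_add t.coe_nonneg hs.1,
      Real.toNNReal_coe, adjoint_add_apply]
    congr 2
    push_cast
    ring

end C0Semigroup

namespace C0Semigroup

open scoped InnerProduct

variable {H : Type*} [NormedAddCommGroup H] [InnerProductSpace ℂ H] [CompleteSpace H]
  {V V₁ V₂ : C0Semigroup H}

/-- The joint eigenvectors of the operators `(V t)^*` for the eigenvalues `exp (-t)`. For the right
shift of `L²(ℝ₊)` they are the multiples of `x ↦ exp (-x)`. -/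
noncomputable def decaySubspace (V : C0Semigroup H) : Submodule ℂ H :=
  ⨅ t : ℝ≥0, LinearMap.ker (((V t)†) - Complex.exp (-(t : ℝ)) • (1 : H →L[ℂ] H)).toLinearMap

theorem mem_decaySubspace {φ : H} :
    φ ∈ V.decaySubspace ↔ ∀ t : ℝ≥0, ((V t)†) φ = Complex.exp (-(t : ℝ)) • φ := by
  simp [decaySubspace, Submodule.mem_iInf, sub_eq_zero]

theorem isClosed_decaySubspace (V : C0Semigroup H) : IsClosed (V.decaySubspace : Set H) := by
  rw [decaySubspace, Submodule.coe_iInf]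
  exact isClosed_iInter fun t => ContinuousLinearMap.isClosed_ker _

/-- If `re μ = 1`, an eigenvector `φ` for the eigenvalues `exp (-μ t)` yields the eigenvector
`φ + (μ - 1) ∫ exp (-s) V_s φ ds` for the eigenvalues `exp (-t)`. For the right shift this turns
`exp (-μ x)` into `exp (-x)`. -/
theorem IsIsometric.exists_mem_decaySubspace_of_eigenvector (hV : V.IsIsometric)
    {N : Submodule ℂ H} (hN : V.IsReducing N) {μ : ℂ} (hμ : μ.re = 1) {φ : H} (hφ : φ ∈ N)
    (hφ0 : φ ≠ 0) (h : ∀ t : ℝ≥0, ((V t)†) φ = Complex.exp (-(μ * t)) • φ) :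
    ∃ φ' ∈ N, φ' ≠ 0 ∧ φ' ∈ V.decaySubspace := by
  by_cases hμ1 : μ = 1
  · exact ⟨φ, hφ, hφ0, mem_decaySubspace.2 fun t => by simp [h, hμ1]⟩
  have hc : μ - 1 ≠ 0 := sub_ne_zero.2 hμ1
  let g : ℝ → H := fun s => Complex.exp (-s) • V s.toNNReal φ
  have hgc : Continuous g := by
    have := (V.continuous' φ).comp continuous_real_toNNReal
    simp only [Function.comp_def] at this
    fun_prop
  have hgi : IntegrableOn g (Ioi 0) := by
    refine ((integrableOn_exp_neg_Ioi 0).mul_const ‖φ‖).mono' hgc.aestronglyMeasurable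
      (.of_forall fun s => ?_)
    simp only [g]
    rw [norm_smul, hV, Complex.norm_exp]
    simp
  have hRN : ∫ s in Ioi 0, g s ∈ N :=
    Submodule.integral_mem_of_isClosed hN.1 fun s => N.smul_mem _ (hN.2 _ φ hφ).1
  refine ⟨φ + (μ - 1) • ∫ s in Ioi 0, g s, N.add_mem hφ (N.smul_mem _ hRN), fun h0 => ?_,
    mem_decaySubspace.2 fun t => ?_⟩
  -- `⟪φ, φ'⟫ = 2 ‖φ‖² / (1 + conj μ)`, so `φ'` is not zero.
  · have hre : 0 < (1 + (starRingEnd ℂ) μ).re := by simp [hμ]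
    have hne : 1 + (starRingEnd ℂ) μ ≠ 0 := fun h0 => by simp [h0] at hre
    have hR : inner ℂ φ (∫ s in Ioi 0, g s) =
        (1 + (starRingEnd ℂ) μ)⁻¹ * inner ℂ φ φ := by
      rw [← innerSL_apply_apply ℂ, ← ContinuousLinearMap.integral_comp_comm _ hgi]
      have : ∀ s ∈ Ioi (0 : ℝ), innerSL ℂ φ (g s) =
          Complex.exp (-(1 + (starRingEnd ℂ) μ) * s) * inner ℂ φ φ := by
        intro s hs
        simp only [g]
        rw [innerSL_apply_apply, inner_smul_right, ← ContinuousLinearMap.adjoint_inner_left, h,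
          inner_smul_left, ← Complex.exp_conj, ← mul_assoc, ← Complex.exp_add]
        congr 2
        have : (s.toNNReal : ℂ) = s := by
          rw [show (s.toNNReal : ℂ) = ((s.toNNReal : ℝ) : ℂ) from rfl, Real.coe_toNNReal s hs.le]
        rw [this, map_neg, map_mul, Complex.conj_ofReal]
        ring
      rw [setIntegral_congr_fun measurableSet_Ioi this, integral_mul_const,
        integral_exp_mul_complex_Ioi (by rw [Complex.neg_re]; linarith), Complex.ofReal_zero,
        mul_zero, Complex.exp_zero, neg_div_neg_eq, one_div]
    have h1 : inner ℂ φ (φ + (μ - 1) • ∫ s in Ioi 0, g s) = 0 := by rw [h0, inner_zero_right]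
    rw [inner_add_right, inner_smul_right, hR] at h1
    have h2 : (1 + (starRingEnd ℂ) μ + (μ - 1)) * inner ℂ φ φ = 0 := by
      have := congrArg (fun z => (1 + (starRingEnd ℂ) μ) * z) h1
      simp only [mul_zero, mul_add] at this
      rw [← this]
      field_simp
    have h3 : 1 + (starRingEnd ℂ) μ + (μ - 1) = 2 := by
      rw [show 1 + (starRingEnd ℂ) μ + (μ - 1) = μ + (starRingEnd ℂ) μ by ring, Complex.add_conj, hμ]
      simp
    rw [h3] at h2
    exact hφ0 (inner_self_eq_zero.1 ((mul_eq_zero.1 h2).resolve_left two_ne_zero))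
  -- Split the integral at `t`: below `t` the operator `(V t)^*` acts through the eigenvalue equation
  -- for `φ`, above `t` it translates the integrand.
  · have hR : ((V t)†) (∫ s in Ioi 0, g s) =
        ((Complex.exp (-(t : ℝ)) - Complex.exp (-(μ * t))) / (μ - 1)) • φ +
          Complex.exp (-(t : ℝ)) • ∫ s in Ioi 0, g s := by
      rw [← ContinuousLinearMap.integral_comp_comm _ hgi]
      have hgt : IntegrableOn (fun s => ((V t)†) (g s)) (Ioi 0) :=
        ContinuousLinearMap.integrable_comp _ hgi
      rw [← intervalIntegral.integral_interval_add_Ioi (b := (t : ℝ)) hgt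
        (hgt.mono_set (Ioi_subset_Ioi t.coe_nonneg))]
      congr 1
      · have : ∀ s ∈ uIcc (0 : ℝ) t, ((V t)†) (g s) =
            (Complex.exp (-(μ * t)) * Complex.exp ((μ - 1) * s)) • φ := by
          intro s hs
          rw [uIcc_of_le t.coe_nonneg] at hs
          obtain ⟨r, hr⟩ := exists_add_of_le (Real.toNNReal_le_iff_le_coe.2 hs.2)
          have hr' : (t : ℂ) = s + r := by
            have : (t : ℝ) = s + r := by
              conv_lhs => rw [hr, NNReal.coe_add, Real.coe_toNNReal s hs.1]
            exact_mod_cast congrArg (Complex.ofReal) this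
          simp only [g]
          conv_lhs => rw [hr, map_smul, hV.adjoint_add_apply_left, h, smul_smul, ← Complex.exp_add]
          rw [← Complex.exp_add, hr']
          congr 2
          ring
        rw [intervalIntegral.integral_congr this, intervalIntegral.integral_smul_const,
          intervalIntegral.integral_const_mul, integral_exp_mul_complex hc]
        congr 1
        rw [mul_div_assoc', mul_sub, ← Complex.exp_add]
        simp
        ring_nf
      · have := (measurePreserving_add_right (volume : Measure ℝ) (t : ℝ)).setIntegral_preimage_emb
          (measurableEmbedding_addRight (t : ℝ)) (fun s => ((V t)†) (g s)) (Ioi (t : ℝ))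
        rw [← this, preimage_add_const_Ioi, sub_self, ← integral_smul]
        refine setIntegral_congr_fun measurableSet_Ioi fun s hs => ?_
        simp only [g]
        rw [map_smul, add_comm s, Real.toNNReal_add t.coe_nonneg (le_of_lt hs), Real.toNNReal_coe,
          hV.adjoint_apply_add, smul_smul, ← Complex.exp_add]
        congr 2
        push_cast
        ring
    rw [map_add, map_smul, h, hR, smul_add, smul_smul, mul_div_cancel₀ _ hc]
    module

/-- If `V` is not unitary on `N`, then some nonzero vector of `N` is killed by some `(V a)^*`;
it gives rise to an eigenvector. -/
theorem IsIsometric.exists_mem_decaySubspace (hV : V.IsIsometric) (hcnu : V.IsCNU)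
    {N : Submodule ℂ H} (hN : V.IsReducing N) (hN0 : N ≠ ⊥) :
    ∃ φ ∈ N, φ ≠ 0 ∧ φ ∈ V.decaySubspace := by
  obtain ⟨a, y, hy, hya⟩ : ∃ (a : ℝ≥0) (y : H), y ∈ N ∧ y ≠ V a (((V a)†) y) := by
    by_contra! h0
    refine hcnu ⟨N, hN0, hN, fun t => ⟨fun x _ => hV t x, Subset.antisymm ?_ fun y hy => ?_⟩⟩
    · rintro _ ⟨x, hx, rfl⟩
      exact (hN.2 t x hx).1
    · exact ⟨_, (hN.2 t y hy).2, (h0 t y hy).symm⟩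
  have ha : 0 < a := by
    refine pos_iff_ne_zero.2 fun h0 => hya ?_
    rw [h0, adjoint_zero_apply, V.map_zero']
    rfl
  have hx : y - V a (((V a)†) y) ∈ N := N.sub_mem hy (hN.2 a _ (hN.2 a y hy).2).1
  obtain ⟨ψ, hψ, hψ0, hψa⟩ := hV.exists_adjoint_apply_eq_exp_smul hN ha hx (sub_ne_zero.2 hya)
    (by rw [map_sub, adjoint_apply_self hV, sub_self])
  obtain ⟨μ, hμ, φ, hφ, hφ0, hφt⟩ := hV.exists_adjoint_eigenvector hN ha hψ hψ0 hψa
  exact hV.exists_mem_decaySubspace_of_eigenvector hN hμ hφ hφ0 hφt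

/-! ### The bishift system of a doubly commuting pair -/

theorem DoublyCommute.symm (h : V₁.DoublyCommute V₂) : V₂.DoublyCommute V₁ := by
  refine fun t s => ⟨(h s t).1.symm, ?_⟩
  have := congrArg ContinuousLinearMap.adjoint (h s t).2
  simpa [ContinuousLinearMap.mul_def, ContinuousLinearMap.adjoint_comp] using this

theorem DoublyCommute.apply_comm (h : V₁.DoublyCommute V₂) (t s : ℝ≥0) (x : H) :
    V₁ t (V₂ s x) = V₂ s (V₁ t x) :=
  congrArg (fun A : H →L[ℂ] H => A x) (h t s).1

theorem DoublyCommute.apply_adjoint_comm (h : V₁.DoublyCommute V₂) (t s : ℝ≥0) (x : H) :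
    V₁ t (((V₂ s)†) x) = ((V₂ s)†) (V₁ t x) :=
  congrArg (fun A : H →L[ℂ] H => A x) (h t s).2

theorem DoublyCommute.adjoint_adjoint_comm (h : V₁.DoublyCommute V₂) (t s : ℝ≥0) (x : H) :
    ((V₁ t)†) (((V₂ s)†) x) = ((V₂ s)†) (((V₁ t)†) x) := by
  have := congrArg ContinuousLinearMap.adjoint (h t s).1
  simp only [ContinuousLinearMap.mul_def, ContinuousLinearMap.adjoint_comp] at this
  exact (congrArg (fun A : H →L[ℂ] H => A x) this).symm

theorem DoublyCommute.apply_mem_decaySubspace (h : V₁.DoublyCommute V₂) (s : ℝ≥0) {x : H}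
    (hx : x ∈ V₁.decaySubspace) : V₂ s x ∈ V₁.decaySubspace := by
  rw [mem_decaySubspace] at hx ⊢
  intro t
  rw [← h.symm.apply_adjoint_comm, hx, map_smul]

theorem DoublyCommute.isReducing_inf_decaySubspace (h : V₁.DoublyCommute V₂) {N : Submodule ℂ H}
    (hN : V₂.IsReducing N) : V₂.IsReducing (N ⊓ V₁.decaySubspace) := by
  refine ⟨hN.1.inter V₁.isClosed_decaySubspace, fun s x hx =>
    ⟨⟨(hN.2 s x hx.1).1, h.apply_mem_decaySubspace s hx.2⟩, (hN.2 s x hx.1).2,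
      mem_decaySubspace.2 fun t => ?_⟩⟩
  rw [h.adjoint_adjoint_comm, mem_decaySubspace.1 hx.2, map_smul]

theorem IsIsometric.inner_apply_apply (hV : V.IsIsometric) (t : ℝ≥0) (x y : H) :
    inner ℂ (V t x) (V t y) = inner ℂ x y := by
  rw [← ContinuousLinearMap.adjoint_inner_right, adjoint_apply_self hV]

theorem IsIsometric.inner_apply_apply_of_mem_decaySubspace (hV : V.IsIsometric) (s t : ℝ≥0)
    {x y : H} (hx : x ∈ V.decaySubspace) (hy : y ∈ V.decaySubspace) :
    inner ℂ (V s x) (V t y) = ((Real.exp (-|(s : ℝ) - t|) : ℝ) : ℂ) * inner ℂ x y := by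
  rcases le_total s t with hst | hst
  · obtain ⟨r, rfl⟩ := exists_add_of_le hst
    rw [V.map_add', mul_apply_eq_comp, hV.inner_apply_apply,
      ← ContinuousLinearMap.adjoint_inner_left, mem_decaySubspace.1 hx, inner_smul_left,
      ← Complex.exp_conj]
    simp
  · obtain ⟨r, rfl⟩ := exists_add_of_le hst
    rw [V.map_add', mul_apply_eq_comp, hV.inner_apply_apply,
      ← ContinuousLinearMap.adjoint_inner_right, mem_decaySubspace.1 hy, inner_smul_right]
    simp

theorem IsIsometric.adjoint_apply_apply_of_mem_decaySubspace (hV : V.IsIsometric) (t s : ℝ≥0)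
    {x : H} (hx : x ∈ V.decaySubspace) :
    ∃ (c : ℂ) (r : ℝ≥0), ((V t)†) (V s x) = c • V r x := by
  rcases le_total s t with hst | hst
  · obtain ⟨r, rfl⟩ := exists_add_of_le hst
    refine ⟨Complex.exp (-(r : ℝ)), 0, ?_⟩
    rw [hV.adjoint_add_apply_left, mem_decaySubspace.1 hx, V.map_zero']
    rfl
  · obtain ⟨r, rfl⟩ := exists_add_of_le hst
    exact ⟨1, r, by rw [hV.adjoint_apply_add, one_smul]⟩

/-- The vectors `V₁ s (V₂ u φ)`, with `φ` a common eigenvector, span a dense subspace: the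
orthogonal complement of the span reduces both semigroups. If it were not zero, complete
nonunitarity of `V₁` would give eigenvectors of the `(V₁ t)^*` in it. They form a reducing subspace
of `V₂`, so complete nonunitarity of `V₂` would give a common eigenvector orthogonal to itself. -/
theorem DoublyCommute.isBishiftSystem (h : V₁.DoublyCommute V₂) (h₁ : V₁.IsIsometric)
    (h₂ : V₂.IsIsometric) (c₁ : V₁.IsCNU) (c₂ : V₂.IsCNU) :
    IsBishiftSystem V₁ V₂
      fun s u (φ : (V₁.decaySubspace ⊓ V₂.decaySubspace : Submodule ℂ H)) =>
        V₁ s (V₂ u (φ : H)) where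
  shift₁ t s u φ := by rw [V₁.map_add']; rfl
  shift₂ t s u φ := by rw [V₂.map_add', ← h.apply_comm]; rfl
  gram s u φ s' u' ψ := by
    rw [h₁.inner_apply_apply_of_mem_decaySubspace _ _ (h.apply_mem_decaySubspace _ φ.2.1)
      (h.apply_mem_decaySubspace _ ψ.2.1), h₂.inner_apply_apply_of_mem_decaySubspace _ _ φ.2.2
      ψ.2.2, ← mul_assoc, ← Complex.ofReal_mul]
    rfl
  dense := by
    rw [Submodule.dense_iff_topologicalClosure_eq_top, Submodule.topologicalClosure_eq_top_iff]
    by_contra hN0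
    set N := (Submodule.span ℂ (range fun p : ℝ≥0 × ℝ≥0 ×
      (V₁.decaySubspace ⊓ V₂.decaySubspace : Submodule ℂ H) => V₁ p.1 (V₂ p.2.1 (p.2.2 : H))))ᗮ
      with hN
    have mem {x : H} : x ∈ N ↔ ∀ (s u : ℝ≥0) (φ : H), φ ∈ V₁.decaySubspace →
        φ ∈ V₂.decaySubspace → inner ℂ (V₁ s (V₂ u φ)) x = 0 := by
      rw [hN, mem_orthogonal_span_range]
      exact ⟨fun h s u φ k₁ k₂ => h (s, u, ⟨φ, k₁, k₂⟩),
        fun h p => h p.1 p.2.1 p.2.2 p.2.2.2.1 p.2.2.2.2⟩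
    have cl : IsClosed (N : Set H) := Submodule.isClosed_orthogonal _
    have r₁ : V₁.IsReducing N := by
      refine ⟨cl, fun t x hx => ⟨mem.2 fun s u φ k₁ k₂ => ?_, mem.2 fun s u φ k₁ k₂ => ?_⟩⟩
      · obtain ⟨c, r, hr⟩ := h₁.adjoint_apply_apply_of_mem_decaySubspace t s
          (h.apply_mem_decaySubspace u k₁)
        rw [← ContinuousLinearMap.adjoint_inner_left, hr, inner_smul_left, mem.1 hx _ _ _ k₁ k₂,
          mul_zero]
      · rw [ContinuousLinearMap.adjoint_inner_right, ← mul_apply_eq_comp, ← V₁.map_add',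
          mem.1 hx _ _ _ k₁ k₂]
    have r₂ : V₂.IsReducing N := by
      refine ⟨cl, fun t x hx => ⟨mem.2 fun s u φ k₁ k₂ => ?_, mem.2 fun s u φ k₁ k₂ => ?_⟩⟩
      · obtain ⟨c, r, hr⟩ := h₂.adjoint_apply_apply_of_mem_decaySubspace t u k₂
        rw [← ContinuousLinearMap.adjoint_inner_left, ← h.apply_adjoint_comm, hr, map_smul,
          inner_smul_left, mem.1 hx _ _ _ k₁ k₂, mul_zero]
      · rw [ContinuousLinearMap.adjoint_inner_right, ← h.apply_comm,
          ← mul_apply_eq_comp (V₂ t), ← V₂.map_add', mem.1 hx _ _ _ k₁ k₂]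
    obtain ⟨φ₁, hφ₁, hφ₁0, k₁⟩ := h₁.exists_mem_decaySubspace c₁ r₁ hN0
    obtain ⟨φ, hφ, hφ0, k₂⟩ := h₂.exists_mem_decaySubspace c₂ (h.isReducing_inf_decaySubspace r₂)
      fun hbot => hφ₁0 ((Submodule.eq_bot_iff _).1 hbot φ₁ ⟨hφ₁, k₁⟩)
    have := mem.1 hφ.1 0 0 φ hφ.2 k₂
    rw [V₁.map_zero', V₂.map_zero'] at this
    exact hφ0 (inner_self_eq_zero.1 this)

end C0Semigroup

/-! ### Density criteria and Hilbert space tensor products -/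

section Density

/-- An integrable function whose integrals over a generating π-system and over the whole space
vanish is zero. -/
theorem MeasureTheory.Integrable.ae_eq_zero_of_forall_isPiSystem {X : Type*}
    [m : MeasurableSpace X] {μ : Measure X} {g : X → ℂ} (hg : Integrable g μ) {C : Set (Set X)}
    (hC : IsPiSystem C) (hgen : m = MeasurableSpace.generateFrom C)
    (h : ∀ A ∈ insert univ C, ∫ x in A, g x ∂μ = 0) : g =ᵐ[μ] 0 := by
  have h0 : ∫ x, g x ∂μ = 0 := by simpa using h univ (mem_insert _ _)
  refine hg.ae_eq_zero_of_forall_setIntegral_eq_zero fun A hA hfin => ?_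
  clear hfin
  induction A, hA using MeasurableSpace.induction_on_inter hgen hC with
  | empty => simp
  | basic A hA => exact h A (mem_insert_of_mem _ hA)
  | compl A hA ih => rw [setIntegral_compl hA hg, h0, ih, sub_zero]
  | iUnion f hd hm ih =>
    rw [integral_iUnion hm hd hg.integrableOn]
    simp [ih]

/-- If, up to scalars, the `e i` include the truncations of a nowhere vanishing `w` to all sets of
a generating π-system, then they span a dense subspace of `L²`. -/
theorem dense_span_range_of_indicator {X ι : Type*} [m : MeasurableSpace X] {μ : Measure X}
    {C : Set (Set X)} (hC : IsPiSystem C) (hgen : m = MeasurableSpace.generateFrom C)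
    {w : X → ℂ} (hw : MemLp w 2 μ) (hw0 : ∀ x, w x ≠ 0) {e : ι → Lp ℂ 2 μ}
    (he : ∀ A ∈ insert univ C, ∃ (i : ι) (c : ℂ), A.indicator w =ᵐ[μ] fun x => c * e i x) :
    Dense (Submodule.span ℂ (range e) : Set (Lp ℂ 2 μ)) := by
  rw [Submodule.dense_iff_topologicalClosure_eq_top, Submodule.topologicalClosure_eq_top_iff,
    Submodule.eq_bot_iff]
  intro f hf
  have hms : ∀ A ∈ insert univ C, MeasurableSet A := by
    rintro A (rfl | hA)
    · exact .univ
    · rw [hgen]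
      exact MeasurableSpace.measurableSet_generateFrom hA
  have hg : Integrable (fun x => (starRingEnd ℂ) (w x) * f x) μ :=
    MemLp.integrable_mul (p := 2) (q := 2) hw.star (Lp.memLp f)
  have h := hg.ae_eq_zero_of_forall_isPiSystem hC hgen fun A hA => by
    obtain ⟨i, c, hi⟩ := he A hA
    have h1 := mem_orthogonal_span_range.1 hf i
    rw [L2.inner_def] at h1
    rw [← integral_indicator (hms A hA)]
    calc _ = ∫ x, (starRingEnd ℂ) c * inner ℂ (e i x) (f x) ∂μ := by
          refine integral_congr_ae ?_
          filter_upwards [hi] with x hx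
          by_cases hxA : x ∈ A
          · rw [indicator_of_mem hxA] at hx ⊢
            rw [hx, RCLike.inner_apply, map_mul]
            ring
          · rw [indicator_of_notMem hxA] at hx ⊢
            have := congrArg (starRingEnd ℂ) hx
            rw [map_zero, map_mul] at this
            rw [RCLike.inner_apply, mul_comm (f x), ← mul_assoc, ← this, zero_mul]
      _ = 0 := by rw [integral_const_mul, h1, mul_zero]
  refine (Lp.eq_zero_iff_ae_eq_zero).2 ?_
  filter_upwards [h] with x hx
  exact (mul_eq_zero.1 hx).resolve_left (by simpa using hw0 x)

variable {E F : Type*} [NormedAddCommGroup E] [InnerProductSpace ℂ E] [NormedAddCommGroup F]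
  [InnerProductSpace ℂ F]

theorem ContinuousLinearMap.mem_of_forall_mem_of_dense_span {ι : Type*} {v : ι → E}
    (hv : Dense (Submodule.span ℂ (range v) : Set E)) (f : E →L[ℂ] F) {S : Submodule ℂ F}
    (hS : IsClosed (S : Set F)) (h : ∀ i, f (v i) ∈ S) (x : E) : f x ∈ S := by
  refine hv.induction (P := fun x => f x ∈ S) (fun x hx => ?_) (hS.preimage f.continuous) x
  have : Submodule.span ℂ (range v) ≤ S.comap f.toLinearMap :=
    Submodule.span_le.2 (by rintro _ ⟨i, rfl⟩; exact h i)
  exact this hx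

/-- The elementary tensor `x ⊗ y` in the Hilbert space tensor product. -/
noncomputable def hilbertTmul (x : E) (y : F) : HilbertTensor E F :=
  ((x ⊗ₜ[ℂ] y : E ⊗[ℂ] F) : HilbertTensor E F)

theorem inner_hilbertTmul (x x' : E) (y y' : F) :
    inner ℂ (hilbertTmul x y) (hilbertTmul x' y') = inner ℂ x x' * inner ℂ y y' := by
  rw [hilbertTmul, hilbertTmul, UniformSpace.Completion.inner_coe, TensorProduct.inner_tmul]

theorem opTensor_hilbertTmul (A : E →L[ℂ] E) (B : F →L[ℂ] F) (x : E) (y : F) :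
    opTensor A B (hilbertTmul x y) = hilbertTmul (A x) (B y) :=
  opTensor_tmul A B x y

theorem dense_span_hilbertTmul {ι κ : Type*} {v : ι → E} {w : κ → F}
    (hv : Dense (Submodule.span ℂ (range v) : Set E))
    (hw : Dense (Submodule.span ℂ (range w) : Set F)) :
    Dense (Submodule.span ℂ (range fun p : ι × κ => hilbertTmul (v p.1) (w p.2)) :
      Set (HilbertTensor E F)) := by
  set S := (Submodule.span ℂ
    (range fun p : ι × κ => hilbertTmul (v p.1) (w p.2))).topologicalClosure with hS
  have cl : IsClosed (S : Set (HilbertTensor E F)) := Submodule.isClosed_topologicalClosure _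
  let J : E ⊗[ℂ] F →L[ℂ] HilbertTensor E F := UniformSpace.Completion.toComplL
  have h₁ (i : ι) (y : F) : hilbertTmul (v i) y ∈ S :=
    (J ∘L TensorProduct.mkL ℂ E F (v i)).mem_of_forall_mem_of_dense_span hw cl
      (fun j => Submodule.le_topologicalClosure _ (Submodule.subset_span ⟨(i, j), rfl⟩)) y
  have h₂ (x : E) (y : F) : hilbertTmul x y ∈ S :=
    (J ∘L (TensorProduct.mkL ℂ E F).flip y).mem_of_forall_mem_of_dense_span hv cl
      (fun i => h₁ i y) x
  have h₃ (z : E ⊗[ℂ] F) : J z ∈ S := by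
    induction z using TensorProduct.induction_on with
    | zero => rw [map_zero]; exact S.zero_mem
    | tmul x y => exact h₂ x y
    | add a b ha hb => rw [map_add]; exact S.add_mem ha hb
  rw [Submodule.dense_iff_topologicalClosure_eq_top, ← hS, Submodule.eq_top_iff']
  exact fun z => UniformSpace.Completion.denseRange_coe.induction_on z cl h₃

/-- A family in `E` that is shifted by `A₁` and `A₂` and has the Gram matrix of translated
exponentials becomes a bishift system over `F` after tensoring with the vectors of `F`. -/
theorem isBishiftSystem_opTensor {A₁ A₂ : ℝ≥0 → E →L[ℂ] E} {e : ℝ≥0 → ℝ≥0 → E}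
    (h₁ : ∀ t s u, A₁ t (e s u) = e (t + s) u) (h₂ : ∀ t s u, A₂ t (e s u) = e s (t + u))
    (hg : ∀ s u s' u', inner ℂ (e s u) (e s' u') =
      ((Real.exp (-|(s : ℝ) - s'|) * Real.exp (-|(u : ℝ) - u'|) : ℝ) : ℂ))
    (hd : Dense (Submodule.span ℂ (range fun p : ℝ≥0 × ℝ≥0 => e p.1 p.2) : Set E)) :
    IsBishiftSystem (fun t => opTensor (A₁ t) (.id ℂ F)) (fun t => opTensor (A₂ t) (.id ℂ F))
      fun s u (φ : F) => hilbertTmul (e s u) φ where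
  shift₁ t s u φ := by rw [opTensor_hilbertTmul, h₁]; rfl
  shift₂ t s u φ := by rw [opTensor_hilbertTmul, h₂]; rfl
  gram s u φ s' u' ψ := by rw [inner_hilbertTmul, hg]
  dense := by
    have := dense_span_hilbertTmul hd (w := (id : F → F)) (by simp)
    have hr : (range fun p : ℝ≥0 × ℝ≥0 × F => hilbertTmul (e p.1 p.2.1) p.2.2) =
        range fun p : (ℝ≥0 × ℝ≥0) × F => hilbertTmul (e p.1.1 p.1.2) p.2 := Set.ext fun z =>
      ⟨fun ⟨⟨s, u, φ⟩, h⟩ => ⟨⟨⟨s, u⟩, φ⟩, h⟩, fun ⟨⟨⟨s, u⟩, φ⟩, h⟩ => ⟨⟨s, u, φ⟩, h⟩⟩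
    rw [hr]
    exact this

end Density

/-! ### The shift models -/

section Model

/-- The function `x ↦ √2 exp (s - x)` for `x ≥ s`, extended by zero: the translate by `s` of a unit
vector of `L²(ℝ₊)`. -/
noncomputable def expTail (s x : ℝ) : ℝ := (Ici s).indicator (fun x => √2 * Real.exp (s - x)) x

theorem measurable_expTail (s : ℝ) : Measurable (expTail s) :=
  Measurable.indicator (by fun_prop) measurableSet_Ici

theorem expTail_mul_expTail (s t x : ℝ) : expTail s x * expTail t x =
    (Ici (max s t)).indicator (fun x => 2 * Real.exp (s + t) * Real.exp (-2 * x)) x := by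
  rw [expTail, expTail, ← inter_indicator_mul, Ici_inter_Ici]
  refine congrArg (fun f => indicator _ f x) (funext fun x => ?_)
  rw [mul_mul_mul_comm, Real.mul_self_sqrt two_pos.le, ← Real.exp_add, mul_assoc, ← Real.exp_add]
  ring_nf

theorem integrable_expTail_mul_expTail (s t : ℝ) :
    Integrable (fun x => expTail s x * expTail t x) halfLine := by
  simp only [expTail_mul_expTail]
  refine Integrable.indicator ?_ measurableSet_Ici
  exact ((integrableOn_Ici_iff_integrableOn_Ioi).2
    (integrableOn_exp_mul_Ioi (by norm_num) 0)).const_mul _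

theorem integral_expTail_mul_expTail (s t : ℝ≥0) :
    ∫ x, expTail s x * expTail t x ∂halfLine = Real.exp (-|(s : ℝ) - t|) := by
  simp only [expTail_mul_expTail]
  have hI : Ici (max (s : ℝ) t) ∩ Ici 0 = Ici (max (s : ℝ) t) :=
    inter_eq_left.2 (Ici_subset_Ici.2 (le_max_of_le_left s.coe_nonneg))
  rw [integral_indicator measurableSet_Ici, Measure.restrict_restrict measurableSet_Ici, hI,
    integral_Ici_eq_integral_Ioi, integral_const_mul, integral_exp_mul_Ioi (by norm_num)]
  have : Real.exp (-|(s : ℝ) - t|) = Real.exp (s + t) * Real.exp (-2 * max (s : ℝ) t) := by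
    rw [← Real.exp_add]
    congr 1
    rcases le_total (s : ℝ) t with h | h
    · rw [max_eq_right h, abs_of_nonpos (by linarith)]
      ring
    · rw [max_eq_left h, abs_of_nonneg (by linarith)]
      ring
  rw [this]
  ring

theorem expTail_sub (s t x : ℝ) : expTail s (x - t) = expTail (t + s) x := by
  simp only [expTail, indicator_apply, mem_Ici, le_sub_iff_add_le', sub_sub_eq_add_sub, add_comm s]

theorem memLp_expTail (s : ℝ) : MemLp (fun x => (expTail s x : ℂ)) 2 halfLine := by
  refine (memLp_two_iff_integrable_sq_norm
    (Complex.measurable_ofReal.comp (measurable_expTail s)).aestronglyMeasurable).2 ?_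
  simpa [sq] using integrable_expTail_mul_expTail s s

theorem quadrant_eq_prod : quadrant = halfLine.prod halfLine := by
  rw [quadrant, Measure.prod_restrict]
  rfl

theorem memLp_expTail_mul_expTail (s u : ℝ) :
    MemLp (fun x : ℝ × ℝ => (expTail s x.1 : ℂ) * expTail u x.2) 2 quadrant := by
  refine (memLp_two_iff_integrable_sq_norm (Measurable.aestronglyMeasurable
    ((Complex.measurable_ofReal.comp ((measurable_expTail s).comp measurable_fst)).mul
    (Complex.measurable_ofReal.comp ((measurable_expTail u).comp measurable_snd))))).2 ?_
  rw [quadrant_eq_prod]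
  refine ((integrable_expTail_mul_expTail s s).mul_prod
    (integrable_expTail_mul_expTail u u)).congr (.of_forall fun x => ?_)
  change _ = ‖(expTail s x.1 : ℂ) * expTail u x.2‖ ^ 2
  simp only [norm_mul, Complex.norm_real, Real.norm_eq_abs, mul_pow, sq_abs]
  ring

theorem indicatorComp_toLp {X : Type*} [MeasurableSpace X] {μ : Measure X} {D : Set X} {g : X → X}
    (hD : MeasurableSet D) (hg : MeasurePreserving g (μ.restrict D) μ) {f k : X → ℂ}
    (hf : MemLp f 2 μ) (hk : MemLp k 2 μ) (h : ∀ᵐ x ∂μ, D.indicator (fun x => f (g x)) x = k x) :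
    indicatorComp hD hg (hf.toLp f) = hk.toLp k := by
  refine Lp.ext ?_
  have h' := (ae_restrict_iff' hD).1 (hg.quasiMeasurePreserving.ae hf.coeFn_toLp)
  filter_upwards [indicatorComp_coeFn hD hg (hf.toLp f), hk.coeFn_toLp, h, h'] with x h₁ h₂ h₃ h₄
  rw [h₁, h₂, ← h₃]
  by_cases hx : x ∈ D
  · rw [indicator_of_mem hx, indicator_of_mem hx, h₄ hx]
  · rw [indicator_of_notMem hx, indicator_of_notMem hx]

theorem inner_toLp {X : Type*} [MeasurableSpace X] {μ : Measure X} {f g : X → ℂ}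
    (hf : MemLp f 2 μ) (hg : MemLp g 2 μ) :
    inner ℂ (hf.toLp f) (hg.toLp g) = ∫ x, (starRingEnd ℂ) (f x) * g x ∂μ := by
  rw [L2.inner_def]
  refine integral_congr_ae ?_
  filter_upwards [hf.coeFn_toLp, hg.coeFn_toLp] with x h₁ h₂
  rw [h₁, h₂, RCLike.inner_apply, mul_comm]

/-- The translated exponential as an element of `L²(ℝ₊)`. -/
noncomputable def halfLineExp (s : ℝ≥0) : Lp ℂ 2 halfLine := (memLp_expTail s).toLp _

/-- The product of two translated exponentials as an element of `L²(ℝ₊²)`. -/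
noncomputable def quadrantExp (s u : ℝ≥0) : Lp ℂ 2 quadrant :=
  (memLp_expTail_mul_expTail s u).toLp _

theorem indicator_expTail (s t x : ℝ) (hs : 0 ≤ s) :
    (Ici t).indicator (fun x => expTail s (x - t)) x = expTail (t + s) x := by
  rw [indicator_apply]
  split_ifs with h
  · exact expTail_sub s t x
  · refine (indicator_of_notMem (fun h' => h ?_) _).symm
    exact (le_add_of_nonneg_right hs).trans h'

theorem rightShift_halfLineExp (t s : ℝ≥0) :
    rightShift t (halfLineExp s) = halfLineExp (t + s) := by
  refine indicatorComp_toLp _ _ _ (memLp_expTail _) (.of_forall fun x => ?_)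
  rw [NNReal.coe_add, ← indicator_expTail s t x s.coe_nonneg]
  simp only [indicator_apply]
  split_ifs <;> simp

theorem quadrantShift₁_quadrantExp (t s u : ℝ≥0) :
    quadrantShift₁ t (quadrantExp s u) = quadrantExp (t + s) u := by
  refine indicatorComp_toLp _ _ _ (memLp_expTail_mul_expTail _ _) (.of_forall fun x => ?_)
  rw [NNReal.coe_add, ← indicator_expTail s t x.1 s.coe_nonneg]
  simp only [indicator_apply, mem_ofPred_eq, mem_Ici]
  split_ifs <;> simp

theorem quadrantShift₂_quadrantExp (t s u : ℝ≥0) :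
    quadrantShift₂ t (quadrantExp s u) = quadrantExp s (t + u) := by
  refine indicatorComp_toLp _ _ _ (memLp_expTail_mul_expTail _ _) (.of_forall fun x => ?_)
  rw [NNReal.coe_add, ← indicator_expTail u t x.2 u.coe_nonneg]
  simp only [indicator_apply, mem_ofPred_eq, mem_Ici]
  split_ifs <;> simp

theorem inner_halfLineExp (s t : ℝ≥0) :
    inner ℂ (halfLineExp s) (halfLineExp t) = (Real.exp (-|(s : ℝ) - t|) : ℝ) := by
  rw [halfLineExp, halfLineExp, inner_toLp, ← integral_expTail_mul_expTail, ← integral_complex_ofReal]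
  simp

theorem inner_quadrantExp (s u s' u' : ℝ≥0) :
    inner ℂ (quadrantExp s u) (quadrantExp s' u') =
      ((Real.exp (-|(s : ℝ) - s'|) * Real.exp (-|(u : ℝ) - u'|) : ℝ) : ℂ) := by
  rw [quadrantExp, quadrantExp, inner_toLp, ← integral_expTail_mul_expTail,
    ← integral_expTail_mul_expTail, ← integral_prod_mul, ← quadrant_eq_prod,
    ← integral_complex_ofReal]
  refine integral_congr_ae (.of_forall fun x => ?_)
  simp only [map_mul, Complex.conj_ofReal]
  push_cast
  ring

/-- A nowhere vanishing function on `ℝ` that agrees with `expTail 0` on `ℝ₊`. Its truncation to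
`[s, ∞)` is a multiple of `expTail s`. -/
noncomputable def expWeight (x : ℝ) : ℝ := √2 * Real.exp (-x)

theorem expWeight_ne_zero (x : ℝ) : expWeight x ≠ 0 :=
  mul_ne_zero (by simp) (Real.exp_pos _).ne'

theorem indicator_expWeight (s x : ℝ) :
    (Ici s).indicator expWeight x = Real.exp (-s) * expTail s x := by
  simp only [expTail, indicator_apply, expWeight, mul_ite, mul_zero, mul_left_comm (Real.exp _),
    ← Real.exp_add, neg_add_cancel_left, sub_eq_add_neg]

theorem expTail_zero_of_nonneg {x : ℝ} (hx : 0 ≤ x) : expTail 0 x = expWeight x := by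
  have := indicator_expWeight 0 x
  rwa [indicator_of_mem (mem_Ici.2 hx), neg_zero, Real.exp_zero, one_mul, eq_comm] at this

theorem mem_Ici_toNNReal_iff {s x : ℝ} (hx : 0 ≤ x) : x ∈ Ici (s.toNNReal : ℝ) ↔ x ∈ Ici s := by
  simp only [mem_Ici, Real.coe_toNNReal', sup_le_iff]
  exact ⟨fun h => h.1, fun h => ⟨h, hx⟩⟩

theorem dense_span_halfLineExp :
    Dense (Submodule.span ℂ (range halfLineExp) : Set (Lp ℂ 2 halfLine)) := by
  have hw : MemLp (fun x => (expWeight x : ℂ)) 2 halfLine := by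
    refine (memLp_expTail 0).ae_eq ?_
    filter_upwards [ae_restrict_mem measurableSet_Ici] with x hx
    rw [expTail_zero_of_nonneg hx]
  refine dense_span_range_of_indicator isPiSystem_Ici
    ((BorelSpace.measurable_eq (α := ℝ)).trans (borel_eq_generateFrom_Ici ℝ)) hw
    (fun x => Complex.ofReal_ne_zero.2 (expWeight_ne_zero x)) fun A hA => ?_
  obtain ⟨s, hs⟩ : ∃ s : ℝ≥0, ∀ x : ℝ, 0 ≤ x → (x ∈ Ici (s : ℝ) ↔ x ∈ A) := by
    obtain rfl | ⟨s, rfl⟩ := hA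
    · exact ⟨0, fun x hx => ⟨fun _ => trivial, fun _ => hx⟩⟩
    · exact ⟨s.toNNReal, fun x hx => mem_Ici_toNNReal_iff hx⟩
  refine ⟨s, Real.exp (-s), ?_⟩
  filter_upwards [(memLp_expTail s).coeFn_toLp, ae_restrict_mem measurableSet_Ici] with x h₁ h₂
  rw [halfLineExp, h₁, ← Complex.ofReal_mul, ← indicator_expWeight]
  by_cases k : x ∈ A
  · rw [indicator_of_mem k, indicator_of_mem ((hs x h₂).2 k)]
  · rw [indicator_of_notMem k, indicator_of_notMem (mt (hs x h₂).1 k), Complex.ofReal_zero]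

theorem dense_span_quadrantExp :
    Dense (Submodule.span ℂ (range fun p : ℝ≥0 × ℝ≥0 => quadrantExp p.1 p.2) :
      Set (Lp ℂ 2 quadrant)) := by
  have hq : ∀ᵐ x ∂quadrant, x ∈ Ici (0 : ℝ) ×ˢ Ici (0 : ℝ) :=
    ae_restrict_mem (measurableSet_Ici.prod measurableSet_Ici)
  have hw : MemLp (fun x : ℝ × ℝ => (expWeight x.1 : ℂ) * expWeight x.2) 2 quadrant := by
    refine (memLp_expTail_mul_expTail 0 0).ae_eq ?_
    filter_upwards [hq] with x hx
    rw [expTail_zero_of_nonneg hx.1, expTail_zero_of_nonneg hx.2]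
  have hspan : IsCountablySpanning (range (Ici : ℝ → Set ℝ)) := by
    refine ⟨fun n : ℕ => Ici (-n : ℝ), fun n => ⟨_, rfl⟩, eq_univ_of_forall fun x => ?_⟩
    obtain ⟨n, hn⟩ := exists_nat_ge (-x)
    exact mem_iUnion.2 ⟨n, neg_le.1 hn⟩
  have hb : (borel ℝ) = MeasurableSpace.generateFrom (range Ici) := borel_eq_generateFrom_Ici ℝ
  have hgen : (inferInstance : MeasurableSpace (ℝ × ℝ)) =
      MeasurableSpace.generateFrom (image2 (· ×ˢ ·) (range Ici) (range Ici)) := by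
    rw [← generateFrom_prod_eq hspan hspan, ← hb, ← BorelSpace.measurable_eq (α := ℝ)]
  refine dense_span_range_of_indicator (isPiSystem_Ici.prod isPiSystem_Ici) hgen hw
    (fun x => mul_ne_zero (Complex.ofReal_ne_zero.2 (expWeight_ne_zero _))
      (Complex.ofReal_ne_zero.2 (expWeight_ne_zero _))) fun A hA => ?_
  obtain ⟨s, u, hs⟩ : ∃ s u : ℝ≥0, ∀ x : ℝ × ℝ, x ∈ Ici (0 : ℝ) ×ˢ Ici (0 : ℝ) →
      (x ∈ A ↔ x.1 ∈ Ici (s : ℝ) ∧ x.2 ∈ Ici (u : ℝ)) := by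
    obtain rfl | ⟨_, ⟨s, rfl⟩, _, ⟨u, rfl⟩, rfl⟩ := hA
    · exact ⟨0, 0, fun x hx => ⟨fun _ => hx, fun _ => trivial⟩⟩
    · exact ⟨s.toNNReal, u.toNNReal, fun x hx =>
        (and_congr (mem_Ici_toNNReal_iff hx.1) (mem_Ici_toNNReal_iff hx.2)).symm⟩
  refine ⟨(s, u), Real.exp (-s) * Real.exp (-u), ?_⟩
  filter_upwards [(memLp_expTail_mul_expTail s u).coeFn_toLp, hq] with x h₁ h₂
  rw [quadrantExp, h₁, mul_mul_mul_comm, ← Complex.ofReal_mul, ← Complex.ofReal_mul,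
    ← indicator_expWeight, ← indicator_expWeight]
  by_cases k : x ∈ A
  · have k' := (hs x h₂).1 k
    rw [indicator_of_mem k, indicator_of_mem k'.1, indicator_of_mem k'.2]
  · rw [indicator_of_notMem k]
    rcases not_and_or.1 (mt (hs x h₂).2 k) with k' | k' <;> simp [indicator_of_notMem k']

variable {F : Type*} [NormedAddCommGroup F] [InnerProductSpace ℂ F]

theorem isBishiftSystem_quadrantShift :
    IsBishiftSystem (fun t => opTensor (quadrantShift₁ t) (.id ℂ F))
      (fun t => opTensor (quadrantShift₂ t) (.id ℂ F))
      fun s u (φ : F) => hilbertTmul (quadrantExp s u) φ :=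
  isBishiftSystem_opTensor quadrantShift₁_quadrantExp quadrantShift₂_quadrantExp
    inner_quadrantExp dense_span_quadrantExp

theorem isBishiftSystem_rightShift :
    IsBishiftSystem (fun t => opTensor (opTensor (rightShift t) (.id ℂ _)) (.id ℂ F))
      (fun t => opTensor (opTensor (.id ℂ _) (rightShift t)) (.id ℂ F))
      fun s u (φ : F) => hilbertTmul (hilbertTmul (halfLineExp s) (halfLineExp u)) φ :=
  isBishiftSystem_opTensor
    (fun t s u => by rw [opTensor_hilbertTmul, rightShift_halfLineExp]; rfl)
    (fun t s u => by rw [opTensor_hilbertTmul, rightShift_halfLineExp]; rfl)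
    (fun s u s' u' => by
      rw [inner_hilbertTmul, inner_halfLineExp, inner_halfLineExp, Complex.ofReal_mul])
    (dense_span_hilbertTmul dense_span_halfLineExp dense_span_halfLineExp)

end Model

/-! ### The characterization -/

theorem mainTheorem1 {H : Type*} [NormedAddCommGroup H] [InnerProductSpace ℂ H] [CompleteSpace H]
    (V₁ V₂ : C0Semigroup H) :
    ((V₁.IsIsometric ∧ V₂.IsIsometric ∧ V₁.IsCNU ∧ V₂.IsCNU ∧ V₁.DoublyCommute V₂) ↔
      IsBishift V₁ V₂) ∧
    (IsBishift V₁ V₂ ↔ IsTensorBishift V₁ V₂) := by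
  refine ⟨⟨fun ⟨i₁, i₂, c₁, c₂, h⟩ => ?_, fun ⟨F, _, _, _, hJ⟩ => ?_⟩,
    fun ⟨F, _, _, _, hJ⟩ => ?_, fun ⟨F, _, _, _, hJ⟩ => ?_⟩
  · have : CompleteSpace (V₁.decaySubspace ⊓ V₂.decaySubspace : Submodule ℂ H) :=
      (V₁.isClosed_decaySubspace.inter V₂.isClosed_decaySubspace).completeSpace_coe
    exact ⟨(V₁.decaySubspace ⊓ V₂.decaySubspace : Submodule ℂ H), inferInstance, inferInstance,
      this, (h.isBishiftSystem i₁ i₂ c₁ c₂).jointlyUnitarilyEquivalent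
        isBishiftSystem_quadrantShift⟩
  · obtain ⟨v, hv⟩ := isBishiftSystem_quadrantShift.of_jointlyUnitarilyEquivalent hJ
    exact ⟨hv.isIsometric, hv.swap.isIsometric, hv.isCNU, hv.swap.isCNU, hv.doublyCommute⟩
  · obtain ⟨v, hv⟩ := isBishiftSystem_quadrantShift.of_jointlyUnitarilyEquivalent hJ
    exact ⟨F, _, _, ‹_›, hv.jointlyUnitarilyEquivalent isBishiftSystem_rightShift⟩
  · obtain ⟨v, hv⟩ := isBishiftSystem_rightShift.of_jointlyUnitarilyEquivalent hJ
    exact ⟨F, _, _, ‹_›, hv.jointlyUnitarilyEquivalent isBishiftSystem_quadrantShift⟩
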